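/- Let $\mathbb{F}$ be $\mathbb{R}$ or $\mathbb{C}$ and $\mathbb{F}[\bm{x}]=\mathbb{F}[x_1,\dots,x_d]$. An ideal projector is a linear idempotent operator $P$ on $\mathbb{F}[\bm{x}]$ whose kernel is an ideal; it is a Lagrange projector if its kernel is the vanishing ideal of a finite subset of $\mathbb{F}^d$. Let $P'$ denote the dual projector on the algebraic dual $\mathbb{F}[\bm{x}]'$, let $\delta_{\bm{\xi}}$ be evaluation at $\bm{\xi}$, and for a polynomial $p=\sum_{\bm\alpha}\hat p(\bm\alpha)\bm{x}^{\bm\alpha}$ let $p(D)=\sum_{\bm\alpha}\hat p(\bm\alpha)\,\partial^{\|\bm\alpha\|_1}/\partial x_1^{\alpha_1}\cdots\partial x_d^{\alpha_d}$. Let $\bm{\xi}^{(1)},\dots,\bm{\xi}^{(\mu+\nu)}\in\mathbb{F}^d$ be distinct points. For $1\le k\le\mu$ let $\Delta^{(k)}\subset\mathbb{N}^d$ be a finite lower set and $\bm{\rho}^{(k)}_1,\dots,\bm{\rho}^{(k)}_d\in\mathbb{F}^d$ linearly independent unit vectors, and put $D^{\bm\alpha}_{\bm\rho^{(k)}}=\partial^{\|\bm\alpha\|_1}/\partial(\bm\rho^{(k)}_1)^{\alpha_1}\cdots\partial(\bm\rho^{(k)}_d)^{\alpha_d}$,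 where $\partial/\partial \bm v=\sum_j v_j\,\partial/\partial x_j$. For $1\le l\le\nu$ let $n(l)\ge1$, let $a^{(l)}_0=1$ and $a^{(l)}_1>\dots>a^{(l)}_{n(l)}\ge2$ be integers, and let $c^{(l)}_{i,j}\in\mathbb{F}$ ($1\le i\le d$, $0\le j\le n(l)$) with $c^{(l)}_{1,0},\dots,c^{(l)}_{d,0}$ not all zero. For $0\le m\le a_1^{(l)}$ put $$q^{(l)}_{n(l),m}=\sum_{\gamma}\Big(\prod_{i,j}\frac{(c^{(l)}_{i,j})^{\gamma_{i,j}}}{\gamma_{i,j}!}\Big)\prod_{i=1}^d x_i^{\sum_j\gamma_{i,j}},$$ the sum being over all $\gamma=(\gamma_{i,j})\in(\mathbb{N}^{n(l)+1})^d$ with $\sum_{j}a^{(l)}_j\sum_{i}\gamma_{i,j}=m$, and let $\bm\phi^{(l)}(t)=\big(\sum_{j}c^{(l)}_{1,j}t^{a^{(l)}_j},\dots,\sum_{j}c^{(l)}_{d,j}t^{a^{(l)}_j}\big)$. Let $P$ be an ideal projector with $$\mathrm{ran}\,P'=\mathrm{span}\{\delta_{\bm\xi^{(k)}}D^{\bm\alpha}_{\bm\rho^{(k)}},\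 \delta_{\bm\xi^{(\mu+l)}}q^{(l)}_{n(l),m}(D):\ 1\le k\le\mu,\ \bm\alpha\in\Delta^{(k)},\ 1\le l\le\nu,\ 0\le m\le a^{(l)}_1\}.$$ Then there is $\eta>0$ such that: (i) for every $h\in\mathbb{F}$ with $0<|h|<\eta$ there is exactly one Lagrange projector $P_h$ with $$\mathrm{ran}\,P_h'=\mathrm{span}\{\delta_{\bm\xi^{(k)}+h\sum_i\alpha_i\bm\rho^{(k)}_i},\ \delta_{\bm\xi^{(\mu+l)}+\bm\phi^{(l)}(mh)}:\ 1\le k\le\mu,\ \bm\alpha\in\Delta^{(k)},\ 1\le l\le\nu,\ 0\le m\le a^{(l)}_1\}$$ and $\mathrm{ran}\,P_h=\mathrm{ran}\,P$; (ii) $P$ is the pointwise limit of these $P_h$ as $h\to0$: for every $f\in\mathbb{F}[\bm{x}]$, every coefficient of $P_hf$ converges to the corresponding coefficient of $Pf$. -/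

import Mathlib

open Topology Filter

noncomputable section

namespace IdealProjector

variable {𝕜 : Type*} [RCLike 𝕜] {d : ℕ}

/-- A linear projector on the polynomial ring whose kernel is an ideal. -/
def IsIdealProjector (P : Module.End 𝕜 (MvPolynomial (Fin d) 𝕜)) : Prop :=
  IsIdempotentElem P ∧
    ∃ I : Ideal (MvPolynomial (Fin d) 𝕜), (I : Set (MvPolynomial (Fin d) 𝕜)) = LinearMap.ker P

/-- A linear projector on the polynomial ring whose kernel is the vanishing ideal of a finite
set of points. -/
def IsLagrangeProjector (P : Module.End 𝕜 (MvPolynomial (Fin d) 𝕜)) : Prop :=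
  IsIdempotentElem P ∧
    ∃ Ξ : Set (Fin d → 𝕜), Ξ.Finite ∧
      (MvPolynomial.vanishingIdeal 𝕜 Ξ : Set (MvPolynomial (Fin d) 𝕜)) = LinearMap.ker P

/-- The range of the dual projector `P'`, a subspace of the algebraic dual of the
polynomial ring. -/
def dualRange (P : Module.End 𝕜 (MvPolynomial (Fin d) 𝕜)) :
    Submodule 𝕜 (Module.Dual 𝕜 (MvPolynomial (Fin d) 𝕜)) :=
  LinearMap.range (LinearMap.dualMap P)

/-- The evaluation functional `δ_ξ`. -/
def evalAt (ξ : Fin d → 𝕜) : Module.Dual 𝕜 (MvPolynomial (Fin d) 𝕜) :=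
  (MvPolynomial.aeval ξ).toLinearMap

/-- The composite `L₁ ^ α₁ ⋯ L_d ^ α_d` of powers of operators. -/
def opPow (L : Fin d → Module.End 𝕜 (MvPolynomial (Fin d) 𝕜)) (α : Fin d → ℕ) :
    Module.End 𝕜 (MvPolynomial (Fin d) 𝕜) :=
  (List.ofFn fun i => L i ^ α i).prod

/-- The differential operator `p(D)` associated with a polynomial `p`. -/
def diffOp (p : MvPolynomial (Fin d) 𝕜) : Module.End 𝕜 (MvPolynomial (Fin d) 𝕜) :=
  ∑ α ∈ p.support, p.coeff α •
    opPow (fun i => (MvPolynomial.pderiv (R := 𝕜) i).toLinearMap) (fun i => α i)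

/-- The directional derivative `∂/∂v = ∑ j, v_j ∂/∂x_j`. -/
def dirDeriv (v : Fin d → 𝕜) : Module.End 𝕜 (MvPolynomial (Fin d) 𝕜) :=
  ∑ j, v j • (MvPolynomial.pderiv (R := 𝕜) j).toLinearMap

/-- The operator `D_ρ^α = ∂^{|α|} / ∂ρ₁^{α₁} ⋯ ∂ρ_d^{α_d}`. -/
def dirDerivPow (ρ : Fin d → Fin d → 𝕜) (α : Fin d → ℕ) :
    Module.End 𝕜 (MvPolynomial (Fin d) 𝕜) :=
  opPow (fun i => dirDeriv (ρ i)) α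

/-- `ρ₁, …, ρ_d` are linearly independent vectors of Euclidean length one. -/
structure IsUnitFrame (ρ : Fin d → Fin d → 𝕜) : Prop where
  linearIndependent : LinearIndependent 𝕜 ρ
  unit : ∀ i, ∑ j, ‖ρ i j‖ ^ 2 = 1

/-- The conditions on the exponents `a = (a₀, …, a_n)` and the coefficients `c_{i,j}`:
`n ≥ 1`, `a₀ = 1`, `a₁ > ⋯ > a_n ≥ 2`, and `c_{1,0}, …, c_{d,0}` are not all zero. -/
structure IsCurveData {n : ℕ} (a : Fin (n + 1) → ℕ) (c : Fin d → Fin (n + 1) → 𝕜) : Prop where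
  one_le : 1 ≤ n
  a_zero : a 0 = 1
  a_anti : ∀ j k : Fin (n + 1), j ≠ 0 → j < k → a k < a j
  two_le : 2 ≤ a (Fin.last n)
  c_ne : ∃ i, c i 0 ≠ 0

/-- `τ(γ) = ∑ j, a_j ∑ i, γ_{i,j}`. -/
def tau {n : ℕ} (a : Fin (n + 1) → ℕ) (γ : Fin d → Fin (n + 1) → ℕ) : ℕ :=
  ∑ j, a j * ∑ i, γ i j

/-- The finite set of all `γ` with `τ(γ) = m` (for positive exponents `a`, the bound
`γ_{i,j} ≤ m` is automatic, see `mem_tauFiber`). -/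
def tauFiber (d : ℕ) {n : ℕ} (a : Fin (n + 1) → ℕ) (m : ℕ) :
    Finset (Fin d → Fin (n + 1) → ℕ) :=
  (Fintype.piFinset fun _ => Fintype.piFinset fun _ => Finset.range (m + 1)).filter
    fun γ => tau a γ = m

theorem mem_tauFiber {n : ℕ} {a : Fin (n + 1) → ℕ} (ha : ∀ j, 0 < a j) {m : ℕ}
    {γ : Fin d → Fin (n + 1) → ℕ} : γ ∈ tauFiber d a m ↔ tau a γ = m := by
  simp only [tauFiber, Finset.mem_filter, Fintype.mem_piFinset, Finset.mem_range,
    and_iff_right_iff_imp]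
  intro h i j
  have h1 : γ i j ≤ ∑ i, γ i j :=
    Finset.single_le_sum (f := fun i => γ i j) (fun _ _ => Nat.zero_le _) (Finset.mem_univ i)
  have h2 : a j * ∑ i, γ i j ≤ tau a γ :=
    Finset.single_le_sum (f := fun j => a j * ∑ i, γ i j) (fun _ _ => Nat.zero_le _)
      (Finset.mem_univ j)
  have h3 : ∑ i, γ i j ≤ a j * ∑ i, γ i j := Nat.le_mul_of_pos_left _ (ha j)
  omega

/-- The polynomial `q_{n,m} = ∑_{τ(γ) = m} (∏ c_{i,j}^{γ_{i,j}} / ∏ γ_{i,j}!) ∏ x_i^{|γ_i|}`. -/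
def qPoly {n : ℕ} (a : Fin (n + 1) → ℕ) (c : Fin d → Fin (n + 1) → 𝕜) (m : ℕ) :
    MvPolynomial (Fin d) 𝕜 :=
  ∑ γ ∈ tauFiber d a m,
    MvPolynomial.C ((∏ i, ∏ j, c i j ^ γ i j) / (∏ i, ∏ j, ((γ i j).factorial : 𝕜))) *
      ∏ i, MvPolynomial.X i ^ (∑ j, γ i j)

/-- The curve `φ(t)`, with coordinates `φ_i(t) = ∑ j, c_{i,j} t^{a_j}`. -/
def curve {n : ℕ} (a : Fin (n + 1) → ℕ) (c : Fin d → Fin (n + 1) → 𝕜) (t : 𝕜) : Fin d → 𝕜 :=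
  fun i => ∑ j, c i j * t ^ a j

/-- The span of the functionals `δ_{ξ^(k)} D_{ρ^(k)}^α`, for `α ∈ Δ^(k)`, and
`δ_{ξ^(μ+l)} q^(l)_{n(l),m}(D)`, for `0 ≤ m ≤ a₁^(l)`. -/
def hermiteSpan {μ ν : ℕ} (ξ : Fin (μ + ν) → Fin d → 𝕜)
    (Δ : Fin μ → Finset (Fin d → ℕ)) (ρ : Fin μ → Fin d → Fin d → 𝕜)
    (n : Fin ν → ℕ) (a : (l : Fin ν) → Fin (n l + 1) → ℕ)
    (c : (l : Fin ν) → Fin d → Fin (n l + 1) → 𝕜) :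
    Submodule 𝕜 (Module.Dual 𝕜 (MvPolynomial (Fin d) 𝕜)) :=
  Submodule.span 𝕜
    ({F | ∃ k : Fin μ, ∃ α ∈ Δ k, F = evalAt (ξ (Fin.castAdd ν k)) ∘ₗ dirDerivPow (ρ k) α} ∪
     {F | ∃ l : Fin ν, ∃ m ≤ a l 1,
        F = evalAt (ξ (Fin.natAdd μ l)) ∘ₗ diffOp (qPoly (a l) (c l) m)})

/-- The span of the evaluations at the points `ξ^(k) + h ∑ i, α_i ρ_i^(k)`, for `α ∈ Δ^(k)`, and
`ξ^(μ+l) + φ^(l)(m h)`, for `0 ≤ m ≤ a₁^(l)`. -/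
def lagrangeSpan {μ ν : ℕ} (ξ : Fin (μ + ν) → Fin d → 𝕜)
    (Δ : Fin μ → Finset (Fin d → ℕ)) (ρ : Fin μ → Fin d → Fin d → 𝕜)
    (n : Fin ν → ℕ) (a : (l : Fin ν) → Fin (n l + 1) → ℕ)
    (c : (l : Fin ν) → Fin d → Fin (n l + 1) → 𝕜) (h : 𝕜) :
    Submodule 𝕜 (Module.Dual 𝕜 (MvPolynomial (Fin d) 𝕜)) :=
  Submodule.span 𝕜
    ({F | ∃ k : Fin μ, ∃ α ∈ Δ k,
        F = evalAt (ξ (Fin.castAdd ν k) + h • ∑ i, (α i : 𝕜) • ρ k i)} ∪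
     {F | ∃ l : Fin ν, ∃ m ≤ a l 1,
        F = evalAt (ξ (Fin.natAdd μ l) + curve (a l) (c l) ((m : 𝕜) * h))})

end IdealProjector

end

/-! Both kinds of functionals have one description. Let Φ be a polynomial map that is an immersion
at 0 with Φ(0) = ξ: the affine map of a frame, or the curve ξ + φ. Up to nonzero factorials, the
Hermite functionals at ξ are the Taylor coefficients at 0 of f ∘ Φ, with exponents α in a finite
lower set. For the curve this is the multinomial expansion of f(ξ + φ(t)): the operator q_{n,m}(D)
at ξ extracts the coefficient of t^m.

A Taylor coefficient of order α is the limit of the normalized finite difference of f ∘ Φ with step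
h. That difference uses only the nodes βh with β ≤ α. The lower set contains all these β, so the
difference is a combination of the prescribed point evaluations (`LocalChart.diffDual_mem`,
`tendsto_finiteDiff`).

The Taylor functionals of all charts are linearly independent (`linearIndependent_coeffDual`), so
ran P has a basis p biorthogonal to them. The matrix of the finite differences on p tends to the
identity, hence is invertible for small h ≠ 0. Interpolating the differences from span p = ran P
then gives a projector P_h. Its dual range is the span of the differences, which are independent and
as many as the evaluations, so the two spans agree. Continuity of matrix inversion gives P_h f → P f
(`exists_lagrange_tendsto`). Uniqueness holds because range and dual range determine a projector. -/

noncomputable section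

namespace IdealProjector

/-! ### Projectors, dual ranges and interpolation in an arbitrary vector space -/

section Interpolation

theorem span_eq_span_of_linearIndependent {K W J : Type*} [Field K] [AddCommGroup W] [Module K W]
    [Fintype J] {L E : J → W}
    (hL : LinearIndependent K L) (h : ∀ j, L j ∈ Submodule.span K (Set.range E)) :
    Submodule.span K (Set.range L) = Submodule.span K (Set.range E) := by
  have : FiniteDimensional K (Submodule.span K (Set.range E)) :=
    FiniteDimensional.span_of_finite K (Set.finite_range E)
  refine Submodule.eq_of_le_of_finrank_le (Submodule.span_le.2 ?_) ?_
  · rintro _ ⟨j, rfl⟩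
    exact h j
  · rw [finrank_span_eq_card hL]
    exact finrank_range_le_card E

variable {K V J : Type*} [Field K] [AddCommGroup V] [Module K V] [Fintype J] [DecidableEq J]

/-- Row rank equals column rank: independence of the `L j` as functions on `V` means that the
vectors `(L j f)_j` span `J → K`, so evaluation against `L` is onto. -/
theorem exists_biorthogonal {L : J → Module.Dual K V} (hL : LinearIndependent K L) :
    ∃ f : J → V, ∀ i j, L j (f i) = (1 : Matrix J J K) j i := by
  have h1 : LinearIndependent K (fun j => (L j : V → K)) :=
    hL.map' (LinearMap.ltoFun K V K K) (LinearMap.ker_eq_bot.2 DFunLike.coe_injective)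
  rw [← span_flip_eq_top_iff_linearIndependent] at h1
  have h2 : LinearMap.range (LinearMap.pi L) = ⊤ := by
    rw [eq_top_iff, ← h1, Submodule.span_le]
    rintro _ ⟨f, rfl⟩
    exact ⟨f, rfl⟩
  choose f hf using fun i : J =>
    LinearMap.range_eq_top.1 h2 (fun j => (1 : Matrix J J K) j i)
  exact ⟨f, fun i j => congrFun (hf i) j⟩

theorem mem_ker_iff_forall_mem_range_dualMap (P : Module.End K V) (f : V) :
    P f = 0 ↔ ∀ F ∈ LinearMap.range (LinearMap.dualMap P), F f = 0 := by
  rw [← Module.forall_dual_apply_eq_zero_iff K]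
  constructor
  · rintro h _ ⟨F, rfl⟩
    exact h F
  · intro h F
    exact h _ ⟨F, rfl⟩

/-- The kernel is the common annihilator of the dual range, so P and Q share it. Thus f - P f is
killed by Q, while Q fixes P f. -/
theorem eq_of_range_eq_of_range_dualMap_eq {P Q : Module.End K V} (hP : IsIdempotentElem P)
    (hQ : IsIdempotentElem Q) (h : LinearMap.range P = LinearMap.range Q)
    (h' : LinearMap.range (LinearMap.dualMap P) = LinearMap.range (LinearMap.dualMap Q)) :
    P = Q := by
  ext f
  have hPP : ∀ f, P (P f) = P f := fun f => LinearMap.congr_fun hP f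
  have hQQ : ∀ f, Q (Q f) = Q f := fun f => LinearMap.congr_fun hQ f
  have h1 : Q (f - P f) = 0 := by
    rw [mem_ker_iff_forall_mem_range_dualMap, ← h', ← mem_ker_iff_forall_mem_range_dualMap,
      map_sub, hPP, sub_self]
  obtain ⟨g, hg⟩ : P f ∈ LinearMap.range Q := h ▸ ⟨f, rfl⟩
  rw [map_sub, sub_eq_zero] at h1
  rw [h1, ← hg, hQQ]

/-- The matrix of values of the functionals `L` on the vectors `p`. -/
def valueMatrix (L : J → Module.Dual K V) (p : J → V) : Matrix J J K :=
  Matrix.of fun j i => L j (p i)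

/-- The projector onto the span of `p` that interpolates the functionals `L`. -/
def interpolation (L : J → Module.Dual K V) (p : J → V) : Module.End K V :=
  ∑ i, ∑ j, (valueMatrix L p)⁻¹ i j • (L j).smulRight (p i)

theorem interpolation_apply (L : J → Module.Dual K V) (p : J → V) (f : V) :
    interpolation L p f = ∑ i, ((valueMatrix L p)⁻¹.mulVec fun j => L j f) i • p i := by
  simp [interpolation, Matrix.mulVec, dotProduct, Finset.sum_smul, mul_smul]

variable {L : J → Module.Dual K V} {p : J → V}

theorem dual_interpolation (h : IsUnit (valueMatrix L p).det) (j : J) (f : V) :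
    L j (interpolation L p f) = L j f := by
  have h1 : (valueMatrix L p).mulVec ((valueMatrix L p)⁻¹.mulVec fun j => L j f) j = L j f := by
    rw [Matrix.mulVec_mulVec, Matrix.mul_nonsing_inv _ h, Matrix.one_mulVec]
  rw [interpolation_apply, map_sum]
  simp only [map_smul, smul_eq_mul]
  rw [← h1]
  exact Finset.sum_congr rfl fun i _ => mul_comm _ _

theorem interpolation_apply_self (h : IsUnit (valueMatrix L p).det) (i : J) :
    interpolation L p (p i) = p i := by
  have h1 : ((valueMatrix L p)⁻¹.mulVec fun j => L j (p i)) = fun k => (1 : Matrix J J K) k i := by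
    rw [← Matrix.nonsing_inv_mul _ h]
    rfl
  rw [interpolation_apply, h1]
  simp [Matrix.one_apply]

theorem isIdempotentElem_interpolation (h : IsUnit (valueMatrix L p).det) :
    IsIdempotentElem (interpolation L p) := by
  ext f
  simp only [Module.End.mul_apply]
  rw [interpolation_apply]
  simp_rw [dual_interpolation h]
  rw [← interpolation_apply]

theorem range_interpolation (h : IsUnit (valueMatrix L p).det) :
    LinearMap.range (interpolation L p) = Submodule.span K (Set.range p) := by
  apply le_antisymm
  · rintro _ ⟨f, rfl⟩
    rw [interpolation_apply]
    exact Submodule.sum_mem _ fun i _ =>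
      Submodule.smul_mem _ _ (Submodule.subset_span ⟨i, rfl⟩)
  · rw [Submodule.span_le]
    rintro _ ⟨i, rfl⟩
    exact ⟨p i, interpolation_apply_self h i⟩

theorem range_dualMap_interpolation (h : IsUnit (valueMatrix L p).det) :
    LinearMap.range (LinearMap.dualMap (interpolation L p)) =
      Submodule.span K (Set.range L) := by
  apply le_antisymm
  · rintro _ ⟨F, rfl⟩
    have h1 : LinearMap.dualMap (interpolation L p) F =
        ∑ i, ∑ j, ((valueMatrix L p)⁻¹ i j * F (p i)) • L j := by
      ext f
      simp [interpolation, mul_comm, mul_left_comm]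
    rw [h1]
    exact Submodule.sum_mem _ fun i _ => Submodule.sum_mem _ fun j _ =>
      Submodule.smul_mem _ _ (Submodule.subset_span ⟨j, rfl⟩)
  · rw [Submodule.span_le]
    rintro _ ⟨j, rfl⟩
    refine ⟨L j, ?_⟩
    ext f
    exact dual_interpolation h j f

theorem linearIndependent_of_isUnit_det (h : IsUnit (valueMatrix L p).det) :
    LinearIndependent K L := by
  rw [Fintype.linearIndependent_iff]
  intro b hb
  have h1 : Matrix.vecMul b (valueMatrix L p) = 0 := by
    ext i
    simpa [Matrix.vecMul, dotProduct, valueMatrix] using LinearMap.congr_fun hb (p i)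
  have h2 : b = 0 := by
    rw [← Matrix.vecMul_one b, ← Matrix.mul_nonsing_inv _ h, ← Matrix.vecMul_vecMul, h1,
      Matrix.zero_vecMul]
  exact congrFun h2

/-- A projector is determined by its range and its dual range, in terms of a biorthogonal
family. -/
theorem exists_biorthogonal_of_range_dualMap_eq {P : Module.End K V} (hP : IsIdempotentElem P)
    (hL : LinearIndependent K L)
    (h : LinearMap.range (LinearMap.dualMap P) = Submodule.span K (Set.range L)) :
    ∃ p : J → V, (∀ i j, L j (p i) = (1 : Matrix J J K) j i) ∧
      LinearMap.range P = Submodule.span K (Set.range p) ∧ ∀ f, P f = ∑ i, L i f • p i := by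
  have hPP : ∀ f, P (P f) = P f := fun f => LinearMap.congr_fun hP f
  obtain ⟨f, hf⟩ := exists_biorthogonal hL
  -- Elements of the dual range are fixed by precomposition with P, so replacing the dual vectors `f
  -- i` by `P (f i)` keeps biorthogonality and lands in ran P.
  have hLP : ∀ j g, L j (P g) = L j g := by
    intro j g
    obtain ⟨F, hF⟩ : L j ∈ LinearMap.range (LinearMap.dualMap P) :=
      h ▸ Submodule.subset_span ⟨j, rfl⟩
    rw [← hF]
    exact congrArg F (hPP g)
  have h1 : valueMatrix L (fun i => P (f i)) = 1 := by
    ext j i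
    simp [valueMatrix, hLP, hf]
  have hu : IsUnit (valueMatrix L (fun i => P (f i))).det := by simp [h1]
  have hsum : ∀ g, P g = ∑ i, L i g • P (f i) := by
    intro g
    -- P and the interpolation projector have the same dual range, hence the same kernel, and the
    -- latter kills this difference.
    have h2 : P (g - ∑ i, L i g • P (f i)) = 0 := by
      rw [mem_ker_iff_forall_mem_range_dualMap, h, ← range_dualMap_interpolation hu,
        ← mem_ker_iff_forall_mem_range_dualMap, interpolation_apply, h1]
      simp [hLP, hf, Matrix.one_apply]
    rw [map_sub, map_sum, sub_eq_zero] at h2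
    simpa [hPP] using h2
  refine ⟨fun i => P (f i), fun i j => by rw [hLP, hf], le_antisymm ?_ ?_, hsum⟩
  · rintro _ ⟨g, rfl⟩
    rw [hsum]
    exact Submodule.sum_mem _ fun i _ =>
      Submodule.smul_mem _ _ (Submodule.subset_span ⟨i, rfl⟩)
  · rw [Submodule.span_le]
    rintro _ ⟨i, rfl⟩
    exact ⟨f i, rfl⟩

end Interpolation

/-! ### Stability of interpolation under pointwise convergence of the functionals -/

section Limit

theorem tendsto_valueMatrix {𝕜 V J : Type*} [RCLike 𝕜] [AddCommGroup V] [Module 𝕜 V]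
    [DecidableEq J] {L : J → Module.Dual 𝕜 V} {Lh : 𝕜 → J → Module.Dual 𝕜 V}
    (hlim : ∀ j f, Tendsto (fun h => Lh h j f) (𝓝[≠] 0) (𝓝 (L j f))) {p : J → V}
    (hp : ∀ i j, L j (p i) = (1 : Matrix J J 𝕜) j i) :
    Tendsto (fun h => valueMatrix (Lh h) p) (𝓝[≠] 0) (𝓝 1) := by
  refine tendsto_pi_nhds.2 fun j => tendsto_pi_nhds.2 fun i => ?_
  rw [← hp i j]
  exact hlim j (p i)

variable {𝕜 V J : Type*} [RCLike 𝕜] [AddCommGroup V] [Module 𝕜 V] [Fintype J] [DecidableEq J]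

theorem eventually_isUnit_det {L : J → Module.Dual 𝕜 V} {Lh : 𝕜 → J → Module.Dual 𝕜 V}
    (hlim : ∀ j f, Tendsto (fun h => Lh h j f) (𝓝[≠] 0) (𝓝 (L j f))) {p : J → V}
    (hp : ∀ i j, L j (p i) = (1 : Matrix J J 𝕜) j i) :
    ∀ᶠ h in 𝓝[≠] (0 : 𝕜), IsUnit (valueMatrix (Lh h) p).det := by
  have h1 : Tendsto (fun h => (valueMatrix (Lh h) p).det) (𝓝[≠] 0) (𝓝 1) := by
    have h2 : Continuous (fun M : Matrix J J 𝕜 => M.det) := continuous_id.matrix_det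
    rw [← Matrix.det_one (n := J) (R := 𝕜)]
    exact (h2.tendsto 1).comp (tendsto_valueMatrix hlim hp)
  filter_upwards [h1.eventually_ne one_ne_zero] with h hh using isUnit_iff_ne_zero.2 hh

theorem tendsto_inv_valueMatrix {L : J → Module.Dual 𝕜 V} {Lh : 𝕜 → J → Module.Dual 𝕜 V}
    (hlim : ∀ j f, Tendsto (fun h => Lh h j f) (𝓝[≠] 0) (𝓝 (L j f))) {p : J → V}
    (hp : ∀ i j, L j (p i) = (1 : Matrix J J 𝕜) j i) :
    Tendsto (fun h => (valueMatrix (Lh h) p)⁻¹) (𝓝[≠] 0) (𝓝 1) := by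
  have h2 : Continuous (fun M : Matrix J J 𝕜 => M.det) := continuous_id.matrix_det
  have h3 : Continuous (fun M : Matrix J J 𝕜 => M.adjugate) := continuous_id.matrix_adjugate
  have h1 : Tendsto (fun h => (valueMatrix (Lh h) p).det) (𝓝[≠] 0) (𝓝 1) := by
    rw [← Matrix.det_one (n := J) (R := 𝕜)]
    exact (h2.tendsto 1).comp (tendsto_valueMatrix hlim hp)
  have h4 : Tendsto (fun h => (valueMatrix (Lh h) p).adjugate) (𝓝[≠] 0) (𝓝 1) := by
    rw [← Matrix.adjugate_one (n := J)]
    exact (h3.tendsto 1).comp (tendsto_valueMatrix hlim hp)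
  have h5 := (h1.inv₀ one_ne_zero).smul h4
  simpa [Matrix.inv_def] using h5

theorem tendsto_interpolation {L : J → Module.Dual 𝕜 V} {Lh : 𝕜 → J → Module.Dual 𝕜 V}
    (hlim : ∀ j f, Tendsto (fun h => Lh h j f) (𝓝[≠] 0) (𝓝 (L j f))) {p : J → V}
    (hp : ∀ i j, L j (p i) = (1 : Matrix J J 𝕜) j i) (F : Module.Dual 𝕜 V) (f : V) :
    Tendsto (fun h => F (interpolation (Lh h) p f)) (𝓝[≠] 0) (𝓝 (F (∑ i, L i f • p i))) := by
  have h1 := tendsto_inv_valueMatrix hlim hp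
  simp only [interpolation_apply, map_sum, map_smul, smul_eq_mul]
  refine tendsto_finsetSum _ fun i _ => Tendsto.mul_const _ ?_
  have h2 : L i f = ∑ j, (1 : Matrix J J 𝕜) i j * L j f := by simp [Matrix.one_apply]
  rw [h2]
  refine tendsto_finsetSum _ fun j _ => Tendsto.mul ?_ (hlim j f)
  exact tendsto_pi_nhds.1 (tendsto_pi_nhds.1 h1 i) j

end Limit

/-! ### Finite differences as approximations of Taylor coefficients -/

section FiniteDifference

variable {𝕜 : Type*} [RCLike 𝕜]

/-- The weights of the `n`-th forward difference divided by `n!`. -/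
def diffWeight (𝕜 : Type*) [RCLike 𝕜] (n s : ℕ) : 𝕜 :=
  (-1) ^ (n - s) * n.choose s / n.factorial

/-- The n-th forward difference annihilates powers below n and sends the n-th power to n!. -/
theorem sum_diffWeight_mul_pow {n k : ℕ} (h : k ≤ n) :
    ∑ s ∈ Finset.range (n + 1), diffWeight 𝕜 n s * (s : 𝕜) ^ k = if k = n then 1 else 0 := by
  have h1 : ∑ s ∈ Finset.range (n + 1), diffWeight 𝕜 n s * (s : 𝕜) ^ k =
      (fwdDiff (1 : 𝕜))^[n] (fun r : 𝕜 => r ^ k) 0 / n.factorial := by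
    rw [fwdDiff_iter_eq_sum_shift, Finset.sum_div]
    refine Finset.sum_congr rfl fun s _ => ?_
    simp [diffWeight]
    ring
  rw [h1]
  split_ifs with hk
  · subst hk
    rw [fwdDiff_iter_eq_factorial]
    simp [Nat.factorial_ne_zero]
  · rw [fwdDiff_iter_pow_eq_zero_of_lt (lt_of_le_of_ne h hk)]
    simp

/-- A tuple of exponents as a finitely supported function. -/
abbrev toExp {e : ℕ} (α : Fin e → ℕ) : Fin e →₀ ℕ := Finsupp.equivFunOnFinite.symm α

theorem prod_X_pow_eq {e : ℕ} (α : Fin e → ℕ) :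
    ∏ i, (MvPolynomial.X i : MvPolynomial (Fin e) 𝕜) ^ α i = MvPolynomial.monomial (toExp α) 1 := by
  rw [MvPolynomial.monomial_eq, Finsupp.prod_fintype _ _ (by simp)]
  simp

/-- The normalized multivariate finite difference with step `h` and order `α` at the origin. -/
def finiteDiff {e : ℕ} (h : 𝕜) (α : Fin e → ℕ) : Module.Dual 𝕜 (MvPolynomial (Fin e) 𝕜) :=
  ∑ β ∈ Fintype.piFinset fun i => Finset.range (α i + 1),
    ((h ^ ∑ i, α i)⁻¹ * ∏ i, diffWeight 𝕜 (α i) (β i)) • evalAt fun i => (β i : 𝕜) * h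

theorem finiteDiff_monomial {e : ℕ} (h : 𝕜) (α : Fin e → ℕ) (κ : Fin e →₀ ℕ) (r : 𝕜) :
    finiteDiff h α (MvPolynomial.monomial κ r) =
      (h ^ ∑ i, α i)⁻¹ * h ^ (∑ i, κ i) * (r *
        ∏ i, ∑ s ∈ Finset.range (α i + 1), diffWeight 𝕜 (α i) s * (s : 𝕜) ^ κ i) := by
  rw [Finset.prod_univ_sum]
  simp only [finiteDiff, LinearMap.sum_apply, LinearMap.smul_apply, evalAt,
    AlgHom.toLinearMap_apply, MvPolynomial.aeval_monomial, smul_eq_mul, Finset.mul_sum]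
  refine Finset.sum_congr rfl fun β _ => ?_
  rw [Finsupp.prod_fintype _ _ (by simp)]
  simp only [mul_pow, Finset.prod_mul_distrib, Finset.prod_pow_eq_pow_sum, Algebra.algebraMap_self,
    RingHom.id_apply]
  ring

theorem tendsto_finiteDiff {e : ℕ} (α : Fin e → ℕ) (g : MvPolynomial (Fin e) 𝕜) :
    Tendsto (fun h : 𝕜 => finiteDiff h α g) (𝓝[≠] 0) (𝓝 (g.coeff (toExp α))) := by
  induction g using MvPolynomial.induction_on' with
  | add p q hp hq => simpa using hp.add hq
  -- The difference factors over the coordinates and scales as h^(|κ| - |α|). For κ = α it is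
  -- constant; if some κ i < α i, a factor vanishes identically; otherwise κ ≥ α with κ ≠ α, and a
  -- positive power of h remains.
  | monomial κ r =>
    simp only [finiteDiff_monomial]
    by_cases hκ : κ = toExp α
    · subst hκ
      have h1 : ∏ i, ∑ s ∈ Finset.range (α i + 1),
          diffWeight 𝕜 (α i) s * (s : 𝕜) ^ (toExp α) i = 1 :=
        Finset.prod_eq_one fun i _ => by
          rw [sum_diffWeight_mul_pow (by simp)]
          simp
      rw [h1, MvPolynomial.coeff_monomial, if_pos rfl]
      refine tendsto_const_nhds.congr' ?_
      filter_upwards [self_mem_nhdsWithin] with h hh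
      have hh : h ≠ 0 := hh
      simp [hh]
    · rw [MvPolynomial.coeff_monomial, if_neg hκ]
      by_cases hlt : ∃ i, κ i < α i
      · obtain ⟨i, hi⟩ := hlt
        have h1 : ∏ i, ∑ s ∈ Finset.range (α i + 1),
            diffWeight 𝕜 (α i) s * (s : 𝕜) ^ κ i = 0 := by
          refine Finset.prod_eq_zero (Finset.mem_univ i) ?_
          rw [sum_diffWeight_mul_pow hi.le, if_neg hi.ne]
        simp [h1]
      · push Not at hlt
        have h1 : ∑ i, α i < ∑ i, κ i := by
          obtain ⟨i, hi⟩ : ∃ i, α i ≠ κ i := by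
            by_contra! hcon
            exact hκ (Finsupp.ext fun i => by simp [hcon])
          exact Finset.sum_lt_sum (fun i _ => hlt i)
            ⟨i, Finset.mem_univ i, lt_of_le_of_ne (hlt i) hi⟩
        obtain ⟨n, hn⟩ := Nat.exists_eq_add_of_lt h1
        set A := r * ∏ i, ∑ s ∈ Finset.range (α i + 1), diffWeight 𝕜 (α i) s * (s : 𝕜) ^ κ i
        have h2 : Tendsto (fun h : 𝕜 => h ^ (n + 1) * A) (𝓝[≠] 0) (𝓝 0) := by
          have h3 : Continuous fun h : 𝕜 => h ^ (n + 1) * A := by fun_prop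
          have h4 := h3.tendsto 0
          simp only [ne_eq, Nat.add_eq_zero_iff, one_ne_zero, and_false, not_false_eq_true,
            zero_pow, zero_mul] at h4
          exact h4.mono_left nhdsWithin_le_nhds
        refine h2.congr' ?_
        filter_upwards [self_mem_nhdsWithin] with h hh
        have hh : h ≠ 0 := hh
        rw [hn, add_assoc, pow_add _ (∑ i, α i), inv_mul_cancel_left₀ (pow_ne_zero _ hh)]

end FiniteDifference

/-! ### Immersed polynomial charts and independence of their Taylor functionals -/

section Chart

/-- A polynomial map `𝕜^e → 𝕜^d` that is an immersion at the origin, with a finite lower set of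
exponents. -/
structure LocalChart (𝕜 : Type*) [RCLike 𝕜] (d : ℕ) where
  dim : ℕ
  map : Fin d → MvPolynomial (Fin dim) 𝕜
  exps : Finset (Fin dim → ℕ)
  isLowerSet : IsLowerSet (exps : Set (Fin dim → ℕ))
  -- The immersion condition in algebraic form: a polynomial left inverse of the chart up to
  -- second-order terms.
  exists_approx : ∃ y : Fin dim → MvPolynomial (Fin d) 𝕜, ∀ i,
    MvPolynomial.aeval map (y i) - MvPolynomial.X i ∈ MvPolynomial.idealOfVars (Fin dim) 𝕜 ^ 2

variable {𝕜 : Type*} [RCLike 𝕜] {d : ℕ}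

namespace LocalChart

/-- The image of the origin. -/
def center (c : LocalChart 𝕜 d) : Fin d → 𝕜 := fun j => MvPolynomial.constantCoeff (c.map j)

/-- The image of a point. -/
def point (c : LocalChart 𝕜 d) (t : Fin c.dim → 𝕜) : Fin d → 𝕜 := fun j => evalAt t (c.map j)

/-- The coefficient of the pullback of a polynomial along the chart. -/
def coeffDual (c : LocalChart 𝕜 d) (α : Fin c.dim → ℕ) :
    Module.Dual 𝕜 (MvPolynomial (Fin d) 𝕜) :=
  MvPolynomial.lcoeff 𝕜 (toExp α) ∘ₗ (MvPolynomial.aeval c.map).toLinearMap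

/-- The finite difference of the pullback of a polynomial along the chart. -/
def diffDual (c : LocalChart 𝕜 d) (h : 𝕜) (α : Fin c.dim → ℕ) :
    Module.Dual 𝕜 (MvPolynomial (Fin d) 𝕜) :=
  finiteDiff h α ∘ₗ (MvPolynomial.aeval c.map).toLinearMap

theorem coeffDual_apply (c : LocalChart 𝕜 d) (α : Fin c.dim → ℕ) (f : MvPolynomial (Fin d) 𝕜) :
    c.coeffDual α f = (MvPolynomial.aeval c.map f).coeff (toExp α) := rfl

theorem evalAt_point (c : LocalChart 𝕜 d) (t : Fin c.dim → 𝕜) :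
    evalAt (c.point t) = evalAt t ∘ₗ (MvPolynomial.aeval c.map).toLinearMap := by
  have h : MvPolynomial.aeval (c.point t) =
      (MvPolynomial.aeval t : MvPolynomial (Fin c.dim) 𝕜 →ₐ[𝕜] 𝕜).comp
        (MvPolynomial.aeval c.map) := by
    ext j
    simp [point, evalAt]
  simp only [evalAt, h]
  rfl

theorem tendsto_diffDual (c : LocalChart 𝕜 d) (α : Fin c.dim → ℕ) (f : MvPolynomial (Fin d) 𝕜) :
    Tendsto (fun h => c.diffDual h α f) (𝓝[≠] 0) (𝓝 (c.coeffDual α f)) :=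
  tendsto_finiteDiff α _

theorem diffDual_eq_sum (c : LocalChart 𝕜 d) (h : 𝕜) (α : Fin c.dim → ℕ) :
    c.diffDual h α = ∑ β ∈ Fintype.piFinset fun i => Finset.range (α i + 1),
      ((h ^ ∑ i, α i)⁻¹ * ∏ i, diffWeight 𝕜 (α i) (β i)) •
        evalAt (c.point fun i => (β i : 𝕜) * h) := by
  ext f
  simp [diffDual, finiteDiff, evalAt_point]

theorem diffDual_mem (c : LocalChart 𝕜 d) (h : 𝕜) {α : Fin c.dim → ℕ} (hα : α ∈ c.exps)
    {S : Submodule 𝕜 (Module.Dual 𝕜 (MvPolynomial (Fin d) 𝕜))}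
    (hS : ∀ β ∈ c.exps, evalAt (c.point fun i => (β i : 𝕜) * h) ∈ S) :
    c.diffDual h α ∈ S := by
  rw [diffDual_eq_sum]
  refine S.sum_mem fun β hβ => S.smul_mem _ (hS β ?_)
  simp only [Fintype.mem_piFinset, Finset.mem_range] at hβ
  exact c.isLowerSet (fun i => Nat.lt_succ_iff.1 (hβ i)) hα

end LocalChart

/-- Replacing one factor v by u costs one extra order of vanishing, and a a' - b b' = a (a' - b') +
(a - b) b' propagates this through products. -/
theorem prod_pow_sub_prod_pow_mem {R ι : Type*} [CommRing R] {I : Ideal R} {u v : ι → R}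
    (hv : ∀ i, v i ∈ I) (huv : ∀ i, u i - v i ∈ I ^ 2) (α : ι → ℕ) (s : Finset ι) :
    ∏ i ∈ s, u i ^ α i - ∏ i ∈ s, v i ^ α i ∈ I ^ (∑ i ∈ s, α i + 1) := by
  have hu : ∀ i, u i ∈ I := fun i => by
    have := I.add_mem (Ideal.pow_le_self two_ne_zero (huv i)) (hv i)
    simpa using this
  have step : ∀ {a b a' b' : R} {m n : ℕ}, a ∈ I ^ m → b' ∈ I ^ n → a - b ∈ I ^ (m + 1) →
      a' - b' ∈ I ^ (n + 1) → a * a' - b * b' ∈ I ^ (m + n + 1) := by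
    intro a b a' b' m n ha hb h h'
    have e : a * a' - b * b' = a * (a' - b') + (a - b) * b' := by ring
    rw [e]
    refine Ideal.add_mem _ ?_ ?_
    · rw [add_assoc, pow_add]
      exact Ideal.mul_mem_mul ha h'
    · rw [add_right_comm, pow_add]
      exact Ideal.mul_mem_mul h hb
  have hpow : ∀ i n, u i ^ n - v i ^ n ∈ I ^ (n + 1) := by
    intro i n
    induction n with
    | zero => simp
    | succ n ih =>
      rw [pow_succ (u i), pow_succ (v i)]
      have hv1 : v i ∈ I ^ 1 := by rw [pow_one]; exact hv i
      have huv1 : u i - v i ∈ I ^ (1 + 1) := by rw [one_add_one_eq_two]; exact huv i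
      exact step (m := n) (n := 1) (Ideal.pow_mem_pow (hu i) n) hv1 ih huv1
  classical
  induction s using Finset.induction_on with
  | empty => simp
  | insert i s hi ih =>
    rw [Finset.prod_insert hi, Finset.prod_insert hi, Finset.sum_insert hi]
    refine step (Ideal.pow_mem_pow (hu i) _) ?_ (hpow i _) ih
    rw [← Finset.prod_pow_eq_pow_sum]
    exact Ideal.prod_mem_prod fun i _ => Ideal.pow_mem_pow (hv i) _

namespace LocalChart

/-- Choose α of maximal total degree with `b α ≠ 0` and test on y^α. Its pullback is x^α plus terms
of degree above |α|, so among the exponents with nonzero weight only α contributes, and it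
contributes `b α`. -/
theorem eq_zero_of_sum_coeffDual_eq_zero (c : LocalChart 𝕜 d) (b : (Fin c.dim → ℕ) → 𝕜)
    (hb : ∀ f, ∑ α ∈ c.exps, b α * c.coeffDual α f = 0) : ∀ α ∈ c.exps, b α = 0 := by
  by_contra! hcon
  obtain ⟨y, hy⟩ := c.exists_approx
  obtain ⟨α, hα, hmax⟩ := Finset.exists_max_image (c.exps.filter fun α => b α ≠ 0)
    (fun α => ∑ i, α i) (by simpa [Finset.Nonempty] using hcon)
  simp only [Finset.mem_filter] at hα hmax
  have h1 := prod_pow_sub_prod_pow_mem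
    (fun i => Ideal.subset_span (Set.mem_range_self i)) hy α Finset.univ
  rw [MvPolynomial.mem_pow_idealOfVars_iff'] at h1
  refine hα.2 ?_
  rw [← hb (∏ i, y i ^ α i), Finset.sum_eq_single_of_mem α hα.1]
  · have h2 := h1 (toExp α) (by simp [Finsupp.degree_eq_sum])
    rw [MvPolynomial.coeff_sub, sub_eq_zero] at h2
    rw [coeffDual_apply, map_prod]
    simp only [map_pow]
    rw [h2, prod_X_pow_eq, MvPolynomial.coeff_monomial, if_pos rfl, mul_one]
  · intro β hβ hne
    by_cases hb0 : b β = 0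
    · rw [hb0, zero_mul]
    have h2 := h1 (toExp β) (by
      simpa [Finsupp.degree_eq_sum, Nat.lt_succ_iff] using hmax β ⟨hβ, hb0⟩)
    rw [MvPolynomial.coeff_sub, sub_eq_zero] at h2
    rw [coeffDual_apply, map_prod]
    simp only [map_pow]
    rw [h2, prod_X_pow_eq, MvPolynomial.coeff_monomial, if_neg, mul_zero]
    exact fun h => hne (Finsupp.equivFunOnFinite.symm.injective h).symm

theorem constantCoeff_aeval_map (c : LocalChart 𝕜 d) (f : MvPolynomial (Fin d) 𝕜) :
    MvPolynomial.constantCoeff (MvPolynomial.aeval c.map f) = evalAt c.center f := by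
  induction f using MvPolynomial.induction_on with
  | C a => simp [evalAt]
  | add p q hp hq => rw [map_add, map_add, map_add, hp, hq]
  | mul_X p i hp =>
    simp only [map_mul, hp]
    simp [evalAt, center]

/-- If u vanishes at the centre, its pullback has no constant term, so the pullback of u^N v has
order at least N. -/
theorem coeffDual_pow_mul_eq_zero (c : LocalChart 𝕜 d) {α : Fin c.dim → ℕ} {N : ℕ}
    (hα : ∑ i, α i < N) {u : MvPolynomial (Fin d) 𝕜} (hu : evalAt c.center u = 0)
    (v : MvPolynomial (Fin d) 𝕜) : c.coeffDual α (u ^ N * v) = 0 := by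
  have h1 : MvPolynomial.aeval c.map u ∈ MvPolynomial.idealOfVars (Fin c.dim) 𝕜 := by
    rw [← pow_one (MvPolynomial.idealOfVars (Fin c.dim) 𝕜),
      MvPolynomial.mem_pow_idealOfVars_iff']
    intro x hx
    have hx0 : x = 0 := (Finsupp.degree_eq_zero_iff x).1 (Nat.lt_one_iff.1 hx)
    rw [hx0, ← MvPolynomial.constantCoeff_eq, constantCoeff_aeval_map, hu]
  have h2 := Ideal.mul_mem_right (MvPolynomial.aeval c.map v) _ (Ideal.pow_mem_pow h1 N)
  rw [← map_pow, ← map_mul, MvPolynomial.mem_pow_idealOfVars_iff'] at h2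
  exact h2 _ (by simpa [Finsupp.degree_eq_sum] using hα)

end LocalChart

theorem exists_separating {K : Type*} [Fintype K] {ξ : K → Fin d → 𝕜}
    (hξ : Function.Injective ξ) (k₀ : K) : ∃ u : MvPolynomial (Fin d) 𝕜,
      evalAt (ξ k₀) u = 1 ∧ ∀ k, k ≠ k₀ → evalAt (ξ k) u = 0 := by
  classical
  have h1 : ∀ k, ∃ u : MvPolynomial (Fin d) 𝕜,
      evalAt (ξ k₀) u = 1 ∧ (k ≠ k₀ → evalAt (ξ k) u = 0) := by
    intro k
    by_cases hk : k = k₀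
    · exact ⟨1, by simp [evalAt], fun h => absurd hk h⟩
    · obtain ⟨j, hj⟩ : ∃ j, ξ k₀ j ≠ ξ k j := by
        by_contra! hcon
        exact hk (hξ (funext hcon)).symm
      refine ⟨MvPolynomial.C (ξ k₀ j - ξ k j)⁻¹ * (MvPolynomial.X j - MvPolynomial.C (ξ k j)),
        ?_, fun _ => ?_⟩
      · simp [evalAt, sub_ne_zero.2 hj]
      · simp [evalAt]
  choose u hu hu' using h1
  refine ⟨∏ k, u k, ?_, fun k hk => ?_⟩
  · simpa [evalAt] using Finset.prod_eq_one fun k _ => hu k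
  · simpa [evalAt] using Finset.prod_eq_zero (Finset.mem_univ k) (hu' k hk)

/-- The index set of the functionals attached to a family of charts. -/
abbrev ChartIndex {K : Type*} (c : K → LocalChart 𝕜 d) : Type _ := Σ k, {α // α ∈ (c k).exps}

/-- A high power of a polynomial separating the centres localizes a relation to a single chart,
where the one-chart case applies. -/
theorem linearIndependent_coeffDual {K : Type*} [Fintype K] (c : K → LocalChart 𝕜 d)
    (hc : Function.Injective fun k => (c k).center) :
    LinearIndependent 𝕜 fun j : ChartIndex c => (c j.1).coeffDual j.2.1 := by
  classical
  rw [Fintype.linearIndependent_iff]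
  rintro b hb ⟨k₀, α₀, hα₀⟩
  obtain ⟨N, hN⟩ : ∃ N, ∀ j : ChartIndex c, ∑ i, j.2.1 i < N := by
    refine ⟨(Finset.univ.sup fun j : ChartIndex c => ∑ i, j.2.1 i) + 1, fun j => ?_⟩
    exact Nat.lt_succ_of_le (Finset.le_sup (f := fun j : ChartIndex c => ∑ i, j.2.1 i)
      (Finset.mem_univ j))
  obtain ⟨u, hu, hu'⟩ := exists_separating hc k₀
  -- The multiplier u^N w = 1 - (1 - u^N)^N acts as 1 on the functionals at k₀, since 1 - u^N
  -- vanishes there, and as 0 on those at every other centre.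
  obtain ⟨w, hw⟩ : u ^ N ∣ 1 - (1 - u ^ N) ^ N := by
    have := sub_dvd_pow_sub_pow (1 : MvPolynomial (Fin d) 𝕜) (1 - u ^ N) N
    simpa using this
  let B : (Fin (c k₀).dim → ℕ) → 𝕜 := fun α => if h : α ∈ (c k₀).exps then b ⟨k₀, α, h⟩ else 0
  have h1 := (c k₀).eq_zero_of_sum_coeffDual_eq_zero B (fun f => by
    have h2 := LinearMap.congr_fun hb (u ^ N * (w * f))
    simp only [LinearMap.sum_apply, LinearMap.smul_apply, LinearMap.zero_apply,
      smul_eq_mul] at h2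
    rw [Fintype.sum_sigma, Finset.sum_eq_single_of_mem k₀ (Finset.mem_univ _)] at h2
    · rw [← h2, ← Finset.sum_coe_sort]
      refine Finset.sum_congr rfl fun α _ => ?_
      have h3 : (c k₀).coeffDual α.1 f = (c k₀).coeffDual α.1 (u ^ N * (w * f)) := by
        have e : f = u ^ N * (w * f) + (1 - u ^ N) ^ N * f := by
          rw [← mul_assoc, ← hw]; ring
        conv_lhs => rw [e]
        rw [map_add, (c k₀).coeffDual_pow_mul_eq_zero (hN ⟨k₀, α⟩) (u := 1 - u ^ N), add_zero]
        have hu2 : MvPolynomial.eval (c k₀).center u = 1 := by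
          rw [← MvPolynomial.coe_aeval_eq_eval]; exact hu
        simp [evalAt, hu2]
      simp [B, h3]
    · intro k _ hk
      refine Finset.sum_eq_zero fun α _ => ?_
      rw [(c k).coeffDual_pow_mul_eq_zero (hN ⟨k, α⟩) (hu' k hk), mul_zero])
  simpa [B, hα₀] using h1 α₀ hα₀

end Chart

variable {𝕜 : Type*} [RCLike 𝕜] {d : ℕ}

/-! ### Differential operators at a point as Taylor coefficients -/

section Derivatives

open MvPolynomial

theorem coeff_pderiv_pow {i : Fin d} (n : ℕ) {m : Fin d →₀ ℕ} (hm : m i = 0)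
    (p : MvPolynomial (Fin d) 𝕜) :
    coeff m (((pderiv (R := 𝕜) i).toLinearMap ^ n) p) =
      n.factorial * coeff (m + Finsupp.single i n) p := by
  induction n generalizing p with
  | zero => simp
  | succ n ih =>
    rw [pow_succ, Module.End.mul_apply, ih, Derivation.coeFn_coe, coeff_pderiv, add_assoc,
      ← Finsupp.single_add]
    simp [hm, Nat.factorial_succ]
    ring

theorem coeff_list_prod_pderiv_pow (α : Fin d → ℕ) (l : List (Fin d)) (hl : l.Nodup)
    (m : Fin d →₀ ℕ) (hm : ∀ i ∈ l, m i = 0) (p : MvPolynomial (Fin d) 𝕜) :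
    coeff m ((l.map fun i => (pderiv (R := 𝕜) i).toLinearMap ^ α i).prod p) =
      (l.map fun i => ((α i).factorial : 𝕜)).prod *
        coeff (m + (l.map fun i => Finsupp.single i (α i)).sum) p := by
  induction l generalizing m with
  | nil => simp
  | cons i l ih =>
    rw [List.nodup_cons] at hl
    rw [List.map_cons, List.prod_cons, Module.End.mul_apply,
      coeff_pderiv_pow _ (hm i (by simp)), ih hl.2]
    · simp [mul_assoc, add_assoc]
    · intro j hj
      have hij : i ≠ j := fun h => hl.1 (h ▸ hj)
      simp [hm j (by simp [hj]), hij]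

theorem coeff_zero_opPow_pderiv (α : Fin d → ℕ) (p : MvPolynomial (Fin d) 𝕜) :
    coeff 0 (opPow (fun i => (pderiv (R := 𝕜) i).toLinearMap) α p) =
      (∏ i, ((α i).factorial : 𝕜)) * coeff (toExp α) p := by
  have hsum : ((List.finRange d).map fun i => Finsupp.single i (α i)).sum = toExp α := by
    rw [← List.ofFn_eq_map, List.sum_ofFn]
    exact Finsupp.univ_sum_single (toExp α)
  rw [opPow, List.ofFn_eq_map, coeff_list_prod_pderiv_pow α _ (List.nodup_finRange d) _
    (fun _ _ => rfl), hsum, zero_add, ← List.ofFn_eq_map, List.prod_ofFn]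

theorem map_opPow {L M : Fin d → Module.End 𝕜 (MvPolynomial (Fin d) 𝕜)}
    {Ψ : MvPolynomial (Fin d) 𝕜 →ₐ[𝕜] MvPolynomial (Fin d) 𝕜}
    (h : ∀ i f, Ψ (L i f) = M i (Ψ f)) (α : Fin d → ℕ) (f : MvPolynomial (Fin d) 𝕜) :
    Ψ (opPow L α f) = opPow M α (Ψ f) := by
  have hpow : ∀ i n f, Ψ ((L i ^ n) f) = (M i ^ n) (Ψ f) := by
    intro i n
    induction n with
    | zero => simp
    | succ n ih => intro f; rw [pow_succ, pow_succ, Module.End.mul_apply, ih, h]; rfl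
  have hlist : ∀ (l : List (Fin d)) f, Ψ ((l.map fun i => L i ^ α i).prod f) =
      (l.map fun i => M i ^ α i).prod (Ψ f) := by
    intro l
    induction l with
    | nil => simp
    | cons i l ih => intro f; simp [hpow, ih]
  simpa [opPow, List.ofFn_eq_map] using hlist (List.finRange d) f

/-- The affine map with value `ξ` at the origin and derivative given by the frame `ρ`. -/
def affineMap (ξ : Fin d → 𝕜) (ρ : Fin d → Fin d → 𝕜) (j : Fin d) : MvPolynomial (Fin d) 𝕜 :=
  C (ξ j) + ∑ i, C (ρ i j) * X i

/-- The chain rule: in the coordinates of the frame, directional derivatives become partial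
derivatives. -/
theorem aeval_affineMap_dirDeriv (ξ : Fin d → 𝕜) (ρ : Fin d → Fin d → 𝕜) (i : Fin d)
    (f : MvPolynomial (Fin d) 𝕜) :
    aeval (affineMap ξ ρ) (dirDeriv (ρ i) f) = pderiv i (aeval (affineMap ξ ρ) f) := by
  have hX : ∀ k, pderiv i (affineMap ξ ρ k) = C (ρ i k) := by
    intro k
    simp [affineMap, pderiv_X, Pi.single_apply]
  induction f using MvPolynomial.induction_on with
  | C r => simp [dirDeriv]
  | add p q hp hq => simp only [map_add, hp, hq]
  | mul_X p k hp =>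
    have h1 : dirDeriv (ρ i) (p * X k) = dirDeriv (ρ i) p * X k + C (ρ i k) * p := by
      simp [dirDeriv, Finset.sum_add_distrib, Finset.mul_sum, pderiv_X, Pi.single_apply,
        smul_eq_C_mul, mul_comm, mul_left_comm, add_comm]
    rw [h1, map_add, map_mul, hp, map_mul, map_mul, Derivation.leibniz, aeval_X, hX]
    simp only [aeval_C, algebraMap_eq, smul_eq_mul]
    ring

theorem evalAt_dirDerivPow (ξ : Fin d → 𝕜) (ρ : Fin d → Fin d → 𝕜) (α : Fin d → ℕ)
    (f : MvPolynomial (Fin d) 𝕜) :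
    evalAt ξ (dirDerivPow ρ α f) =
      (∏ i, ((α i).factorial : 𝕜)) * coeff (toExp α) (aeval (affineMap ξ ρ) f) := by
  have h1 : ∀ g : MvPolynomial (Fin d) 𝕜,
      coeff 0 (aeval (affineMap ξ ρ) g) = evalAt ξ g := by
    intro g
    rw [← constantCoeff_eq]
    induction g using MvPolynomial.induction_on with
    | C a => simp [evalAt]
    | add p q hp hq => rw [map_add, map_add, map_add, hp, hq]
    | mul_X p i hp =>
      simp only [map_mul, hp]
      simp [evalAt, affineMap]
  rw [← h1, dirDerivPow, map_opPow (fun i f => aeval_affineMap_dirDeriv ξ ρ i f),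
    ← coeff_zero_opPow_pderiv]

/-- Translation of polynomials. -/
def translateMap (ξ : Fin d → 𝕜) (j : Fin d) : MvPolynomial (Fin d) 𝕜 := C (ξ j) + X j

theorem evalAt_opPow_pderiv (ξ : Fin d → 𝕜) (α : Fin d → ℕ) (f : MvPolynomial (Fin d) 𝕜) :
    evalAt ξ (opPow (fun i => (pderiv (R := 𝕜) i).toLinearMap) α f) =
      (∏ i, ((α i).factorial : 𝕜)) * coeff (toExp α) (aeval (translateMap ξ) f) := by
  have h1 : translateMap ξ = affineMap ξ (fun i => Pi.single i 1) := by
    ext1 j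
    simp [translateMap, affineMap, Pi.single_apply]
  have h2 : (fun i => (pderiv (R := 𝕜) i).toLinearMap) =
      fun i : Fin d => dirDeriv (Pi.single i (1 : 𝕜)) := by
    ext1 i
    simp [dirDeriv, Pi.single_apply]
  rw [h1, ← evalAt_dirDerivPow, h2, dirDerivPow]

theorem evalAt_diffOp_sum {ι : Type*} (ξ : Fin d → 𝕜) (s : Finset ι) (r : ι → 𝕜)
    (α : ι → Fin d → ℕ) (f : MvPolynomial (Fin d) 𝕜) :
    evalAt ξ (diffOp (∑ γ ∈ s, C (r γ) * ∏ i, X i ^ α γ i) f) =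
      ∑ γ ∈ s, r γ * ((∏ i, ((α γ i).factorial : 𝕜)) *
        coeff (toExp (α γ)) (aeval (translateMap ξ) f)) := by
  -- `diffOp` is a sum over the support, which hides its linearity; the linear extension from the
  -- monomial basis makes it visible.
  let D := (basisMonomials (Fin d) 𝕜).constr 𝕜 fun κ : Fin d →₀ ℕ =>
    opPow (fun i => (pderiv (R := 𝕜) i).toLinearMap) (fun i => κ i)
  have hD1 : ∀ κ : Fin d →₀ ℕ, D (monomial κ 1) =
      opPow (fun i => (pderiv (R := 𝕜) i).toLinearMap) (fun i => κ i) := by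
    intro κ
    have h1 := (basisMonomials (Fin d) 𝕜).constr_basis 𝕜 (fun κ : Fin d →₀ ℕ =>
      opPow (fun i => (pderiv (R := 𝕜) i).toLinearMap) (fun i => κ i)) κ
    rwa [coe_basisMonomials] at h1
  have hD2 : ∀ κ (r : 𝕜), monomial κ r = r • (monomial κ 1 : MvPolynomial (Fin d) 𝕜) := by
    intro κ r
    rw [smul_monomial, smul_eq_mul, mul_one]
  have hD : ∀ p, diffOp p = D p := by
    intro p
    conv_rhs => rw [← support_sum_monomial_coeff p, map_sum]
    refine Finset.sum_congr rfl fun κ _ => ?_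
    rw [hD2, map_smul, hD1]
  rw [hD, map_sum, LinearMap.sum_apply, map_sum]
  refine Finset.sum_congr rfl fun γ _ => ?_
  rw [prod_X_pow_eq, ← smul_eq_C_mul, map_smul, hD1, LinearMap.smul_apply, map_smul, smul_eq_mul]
  exact congrArg _ (evalAt_opPow_pderiv ξ (α γ) f)

end Derivatives

/-! ### The polynomials q_{n,m} and Taylor expansion along a curve -/

section Curve

open MvPolynomial

/-- The curve through the origin as a polynomial map. -/
def curveMap {n : ℕ} (a : Fin (n + 1) → ℕ) (c : Fin d → Fin (n + 1) → 𝕜) (i : Fin d) :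
    MvPolynomial (Fin 1) 𝕜 :=
  ∑ j, C (c i j) * X 0 ^ a j

theorem prod_curveMap_pow {n : ℕ} (a : Fin (n + 1) → ℕ) (c : Fin d → Fin (n + 1) → 𝕜)
    (κ : Fin d → ℕ) :
    ∏ i, curveMap a c i ^ κ i =
      ∑ γ ∈ Fintype.piFinset fun i => Finset.piAntidiag Finset.univ (κ i),
        C ((∏ i, (Nat.multinomial Finset.univ (γ i) : 𝕜)) * ∏ i, ∏ j, c i j ^ γ i j) *
          X 0 ^ tau a γ := by
  simp only [curveMap, Finset.sum_pow_eq_sum_piAntidiag]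
  rw [Finset.prod_univ_sum]
  refine Finset.sum_congr rfl fun γ _ => ?_
  have h1 : tau a γ = ∑ i, ∑ j, a j * γ i j := by
    rw [tau, Finset.sum_comm]
    simp only [Finset.mul_sum]
  simp only [mul_pow, Finset.prod_mul_distrib, h1, map_mul, map_prod, map_pow, map_natCast,
    ← pow_mul, Finset.prod_pow_eq_pow_sum, mul_assoc]

/-- On a monomial this is the multinomial theorem; the factorials are arranged as they arise when
q_{n,m}(D) is applied. -/
theorem coeff_aeval_curveMap {n : ℕ} {a : Fin (n + 1) → ℕ} (ha : ∀ j, 0 < a j)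
    (c : Fin d → Fin (n + 1) → 𝕜) (m : ℕ) (g : MvPolynomial (Fin d) 𝕜) :
    coeff (toExp fun _ => m) (aeval (curveMap a c) g) =
      ∑ γ ∈ tauFiber d a m,
        (∏ i, ∏ j, c i j ^ γ i j) / (∏ i, ∏ j, ((γ i j).factorial : 𝕜)) *
          ((∏ i, ((∑ j, γ i j).factorial : 𝕜)) * coeff (toExp fun i => ∑ j, γ i j) g) := by
  induction g using MvPolynomial.induction_on' with
  | add p q hp hq =>
    rw [map_add, coeff_add, hp, hq, ← Finset.sum_add_distrib]
    refine Finset.sum_congr rfl fun γ _ => ?_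
    rw [coeff_add]
    ring
  | monomial κ r =>
    have hm : (toExp fun _ : Fin 1 => m) = Finsupp.single 0 m := by
      refine Finsupp.ext fun i => ?_
      simp [Subsingleton.elim i 0]
    rw [aeval_monomial, Finsupp.prod_fintype _ _ (by simp), prod_curveMap_pow, algebraMap_eq,
      coeff_C_mul, coeff_sum, Finset.mul_sum, hm]
    simp only [coeff_C_mul, coeff_X_pow, coeff_monomial, mul_ite, mul_one, mul_zero]
    rw [← Finset.sum_filter, ← Finset.sum_filter]
    refine Finset.sum_congr ?_ fun γ hγ => ?_
    -- Only those γ whose row sums are κ see the monomial; both sides reduce to these γ with τ(γ) =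
    -- m.
    · ext γ
      simp only [Finset.mem_filter, Fintype.mem_piFinset, Finset.mem_piAntidiag, mem_tauFiber ha,
        (Finsupp.single_injective (0 : Fin 1)).eq_iff]
      constructor
      · rintro ⟨h1, h2⟩
        exact ⟨h2, Finsupp.ext fun i => by simp [(h1 i).1]⟩
      · rintro ⟨h1, h2⟩
        refine ⟨fun i => ⟨?_, fun _ _ => Finset.mem_univ _⟩, h1⟩
        simp [h2]
    · have h1 : ∀ i, ((∑ j, γ i j).factorial : 𝕜) =
          (∏ j, ((γ i j).factorial : 𝕜)) * Nat.multinomial Finset.univ (γ i) := by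
        intro i
        rw [← Nat.multinomial_spec]
        push_cast
        ring
      have h2 : (∏ i, ∏ j, ((γ i j).factorial : 𝕜)) ≠ 0 :=
        Finset.prod_ne_zero_iff.2 fun i _ => Finset.prod_ne_zero_iff.2 fun j _ =>
          Nat.cast_ne_zero.2 (Nat.factorial_ne_zero _)
      simp only [h1, Finset.prod_mul_distrib]
      field_simp

theorem evalAt_diffOp_qPoly {n : ℕ} {a : Fin (n + 1) → ℕ} (ha : ∀ j, 0 < a j)
    (c : Fin d → Fin (n + 1) → 𝕜) (m : ℕ) (ξ : Fin d → 𝕜) (f : MvPolynomial (Fin d) 𝕜) :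
    evalAt ξ (diffOp (qPoly a c m) f) =
      coeff (toExp fun _ => m) (aeval (fun i => C (ξ i) + curveMap a c i) f) := by
  have h1 : aeval (fun i => C (ξ i) + curveMap a c i) f =
      aeval (curveMap a c) (aeval (translateMap ξ) f) := by
    rw [← AlgHom.comp_apply]
    congr 1
    ext1 i
    simp [translateMap]
  rw [h1, coeff_aeval_curveMap ha, qPoly, evalAt_diffOp_sum]

end Curve

/-! ### Lagrange projectors converging to a projector given by charts -/

theorem isLagrangeProjector_of_dualRange_eq {J : Type*} [Finite J]
    {P : Module.End 𝕜 (MvPolynomial (Fin d) 𝕜)} (hP : IsIdempotentElem P) (x : J → Fin d → 𝕜)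
    (h : dualRange P = Submodule.span 𝕜 (Set.range fun j => evalAt (x j))) :
    IsLagrangeProjector P := by
  refine ⟨hP, Set.range x, Set.finite_range x, ?_⟩
  ext f
  simp only [SetLike.mem_coe, LinearMap.mem_ker, MvPolynomial.mem_vanishingIdeal_iff,
    Set.forall_mem_range]
  rw [mem_ker_iff_forall_mem_range_dualMap]
  change _ ↔ ∀ F ∈ dualRange P, F f = 0
  rw [h]
  constructor
  · intro hf F hF
    induction hF using Submodule.span_induction with
    | mem F hF =>
      obtain ⟨j, rfl⟩ := hF
      exact hf j
    | zero => rfl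
    | add F G _ _ hF hG => rw [LinearMap.add_apply, hF, hG, add_zero]
    | smul r F _ hF => rw [LinearMap.smul_apply, hF, smul_zero]
  · intro hf j
    exact hf _ (Submodule.subset_span ⟨j, rfl⟩)

theorem exists_lagrange_tendsto {K : Type*} [Fintype K] (c : K → LocalChart 𝕜 d)
    (hc : Function.Injective fun k => (c k).center)
    {P : Module.End 𝕜 (MvPolynomial (Fin d) 𝕜)} (hP : IsIdempotentElem P)
    (hP' : dualRange P = Submodule.span 𝕜
      (Set.range fun j : ChartIndex c => (c j.1).coeffDual j.2.1)) :
    ∃ η : ℝ, 0 < η ∧ ∃ Ph : 𝕜 → Module.End 𝕜 (MvPolynomial (Fin d) 𝕜),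
      (∀ h : 𝕜, 0 < ‖h‖ → ‖h‖ < η →
        IsLagrangeProjector (Ph h) ∧
          dualRange (Ph h) = Submodule.span 𝕜 (Set.range fun j : ChartIndex c =>
            evalAt ((c j.1).point fun i => (j.2.1 i : 𝕜) * h)) ∧
          LinearMap.range (Ph h) = LinearMap.range P) ∧
      ∀ (F : Module.Dual 𝕜 (MvPolynomial (Fin d) 𝕜)) (f : MvPolynomial (Fin d) 𝕜),
        Tendsto (fun h : 𝕜 => F (Ph h f)) (𝓝[≠] 0) (𝓝 (F (P f))) := by
  classical
  obtain ⟨p, hp, hrange, hPp⟩ := exists_biorthogonal_of_range_dualMap_eq hP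
    (linearIndependent_coeffDual c hc) hP'
  let Lh : 𝕜 → ChartIndex c → Module.Dual 𝕜 (MvPolynomial (Fin d) 𝕜) :=
    fun h j => (c j.1).diffDual h j.2.1
  have hlim : ∀ (j : ChartIndex c) f,
      Tendsto (fun h => Lh h j f) (𝓝[≠] 0) (𝓝 ((c j.1).coeffDual j.2.1 f)) :=
    fun j f => (c j.1).tendsto_diffDual j.2.1 f
  have hdet := eventually_isUnit_det hlim hp
  rw [eventually_nhdsWithin_iff, Metric.eventually_nhds_iff] at hdet
  obtain ⟨η, hη, hdet⟩ := hdet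
  refine ⟨η, hη, fun h => interpolation (Lh h) p, fun h h0 hh => ?_, fun F f => ?_⟩
  · have hu : IsUnit (valueMatrix (Lh h) p).det :=
      hdet (by simpa using hh) (norm_pos_iff.1 h0)
    have hspan : dualRange (interpolation (Lh h) p) =
        Submodule.span 𝕜 (Set.range fun j : ChartIndex c =>
          evalAt ((c j.1).point fun i => (j.2.1 i : 𝕜) * h)) := by
      rw [dualRange, range_dualMap_interpolation hu]
      -- Each difference is a combination of the evaluations, and both families have the same index
      -- set, so independence of the differences forces equal spans.
      refine span_eq_span_of_linearIndependent (linearIndependent_of_isUnit_det hu) fun j => ?_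
      refine (c j.1).diffDual_mem h j.2.2 fun β hβ => Submodule.subset_span ?_
      exact ⟨⟨j.1, β, hβ⟩, rfl⟩
    exact ⟨isLagrangeProjector_of_dualRange_eq (isIdempotentElem_interpolation hu) _ hspan,
      hspan, by rw [range_interpolation hu, hrange]⟩
  · rw [hPp]
    exact tendsto_interpolation hlim hp F f

/-! ### The affine and curve charts -/

section Charts

open MvPolynomial

/-- The affine chart at `ξ` attached to a frame `ρ`. -/
def frameChart (ξ : Fin d → 𝕜) (ρ : Fin d → Fin d → 𝕜) (hρ : LinearIndependent 𝕜 ρ)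
    (Δ : Finset (Fin d → ℕ)) (hΔ : IsLowerSet (Δ : Set (Fin d → ℕ))) : LocalChart 𝕜 d where
  dim := d
  map := affineMap ξ ρ
  exps := Δ
  isLowerSet := hΔ
  exists_approx := by
    have hu : IsUnit (Matrix.of ρ).det :=
      (Matrix.isUnit_iff_isUnit_det _).1 (Matrix.linearIndependent_rows_iff_isUnit.1 hρ)
    -- The inverse affine map, which is an exact left inverse.
    refine ⟨fun i => ∑ j, C ((Matrix.of ρ)⁻¹ j i) * (X j - C (ξ j)), fun i => ?_⟩
    have h1 : aeval (affineMap ξ ρ) (∑ j, C ((Matrix.of ρ)⁻¹ j i) * (X j - C (ξ j))) = X i := by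
      have h2 : ∀ k, ∑ j, (Matrix.of ρ)⁻¹ j i * ρ k j = (1 : Matrix (Fin d) (Fin d) 𝕜) k i := by
        intro k
        rw [← Matrix.mul_nonsing_inv _ hu, Matrix.mul_apply]
        exact Finset.sum_congr rfl fun j _ => mul_comm _ _
      simp only [map_sum, map_mul, map_sub, aeval_X, aeval_C, algebraMap_eq, affineMap,
        add_sub_cancel_left, Finset.mul_sum]
      rw [Finset.sum_comm]
      simp only [← mul_assoc, ← map_mul, ← Finset.sum_mul, ← map_sum, h2]
      simp [Matrix.one_apply]
    rw [h1, sub_self]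
    exact Ideal.zero_mem _

/-- The chart at `ξ` attached to the curve `ξ + φ`. -/
def curveChart {n : ℕ} (ξ : Fin d → 𝕜) (a : Fin (n + 1) → ℕ) (c : Fin d → Fin (n + 1) → 𝕜)
    (h : IsCurveData a c) : LocalChart 𝕜 d where
  dim := 1
  map := fun i => C (ξ i) + curveMap a c i
  exps := (Finset.range (a 1 + 1)).image fun m _ => m
  isLowerSet := by
    intro α β hβα hα
    simp only [Finset.coe_image, Set.mem_image, Finset.mem_coe, Finset.mem_range] at hα ⊢
    obtain ⟨m, hm, rfl⟩ := hα
    refine ⟨β 0, lt_of_le_of_lt (hβα 0) hm, ?_⟩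
    ext i
    rw [Subsingleton.elim i 0]
  exists_approx := by
    obtain ⟨i₀, hi₀⟩ := h.c_ne
    have ha : ∀ j : Fin n, 2 ≤ a j.succ := by
      intro j
      rcases eq_or_lt_of_le (Fin.le_last j.succ) with hj | hj
      · rw [hj]
        exact h.two_le
      · exact h.two_le.trans (h.a_anti _ _ (Fin.succ_ne_zero j) hj).le
    -- A coordinate with nonzero linear coefficient, recentred and normalized, restricts to t plus
    -- powers t^(a_j) with a_j ≥ 2.
    refine ⟨fun _ => C (c i₀ 0)⁻¹ * (X i₀ - C (ξ i₀)), fun i => ?_⟩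
    have h1 : aeval (fun i => C (ξ i) + curveMap a c i) (C (c i₀ 0)⁻¹ * (X i₀ - C (ξ i₀))) -
        (X i : MvPolynomial (Fin 1) 𝕜) =
        ∑ j : Fin n, C ((c i₀ 0)⁻¹ * c i₀ j.succ) * X 0 ^ a j.succ := by
      rw [Subsingleton.elim i 0]
      simp only [map_mul, map_sub, aeval_X, aeval_C, algebraMap_eq, add_sub_cancel_left, curveMap,
        Fin.sum_univ_succ, h.a_zero, pow_one, mul_add, Finset.mul_sum]
      rw [← mul_assoc, ← map_mul, inv_mul_cancel₀ hi₀]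
      simp [mul_assoc]
    rw [h1]
    exact Ideal.sum_mem _ fun j _ => Ideal.mul_mem_left _ _ (Ideal.pow_le_pow_right (ha j)
      (Ideal.pow_mem_pow (Ideal.subset_span (Set.mem_range_self 0)) _))

theorem center_frameChart (ξ : Fin d → 𝕜) (ρ : Fin d → Fin d → 𝕜) (hρ : LinearIndependent 𝕜 ρ)
    (Δ : Finset (Fin d → ℕ)) (hΔ : IsLowerSet (Δ : Set (Fin d → ℕ))) :
    (frameChart ξ ρ hρ Δ hΔ).center = ξ := by
  ext j
  change constantCoeff (affineMap ξ ρ j) = ξ j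
  simp [affineMap]

theorem point_frameChart (ξ : Fin d → 𝕜) (ρ : Fin d → Fin d → 𝕜) (hρ : LinearIndependent 𝕜 ρ)
    (Δ : Finset (Fin d → ℕ)) (hΔ : IsLowerSet (Δ : Set (Fin d → ℕ))) (h : 𝕜) (α : Fin d → ℕ) :
    (frameChart ξ ρ hρ Δ hΔ).point (fun i => (α i : 𝕜) * h) =
      ξ + h • ∑ i, (α i : 𝕜) • ρ i := by
  ext j
  change aeval (fun i => (α i : 𝕜) * h) (affineMap ξ ρ j) = _
  simp only [affineMap, map_add, map_sum, map_mul, aeval_X, aeval_C, Algebra.algebraMap_self,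
    RingHom.id_apply, Pi.add_apply, Pi.smul_apply, Finset.sum_apply, smul_eq_mul, Finset.mul_sum]
  congr 1
  exact Finset.sum_congr rfl fun i _ => by ring

theorem evalAt_comp_dirDerivPow_eq (ξ : Fin d → 𝕜) (ρ : Fin d → Fin d → 𝕜)
    (hρ : LinearIndependent 𝕜 ρ) (Δ : Finset (Fin d → ℕ))
    (hΔ : IsLowerSet (Δ : Set (Fin d → ℕ))) (α : Fin d → ℕ) :
    evalAt ξ ∘ₗ dirDerivPow ρ α =
      (∏ i, ((α i).factorial : 𝕜)) • (frameChart ξ ρ hρ Δ hΔ).coeffDual α := by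
  refine LinearMap.ext fun f => ?_
  exact evalAt_dirDerivPow ξ ρ α f

variable {n : ℕ} (ξ : Fin d → 𝕜) {a : Fin (n + 1) → ℕ} {c : Fin d → Fin (n + 1) → 𝕜}

theorem IsCurveData.pos (h : IsCurveData a c) (j : Fin (n + 1)) : 0 < a j := by
  by_cases hj : j = 0
  · rw [hj, h.a_zero]
    exact one_pos
  · rcases eq_or_lt_of_le (Fin.le_last j) with hl | hl
    · rw [hl]
      exact two_pos.trans_le h.two_le
    · exact (Nat.zero_le _).trans_lt (h.a_anti _ _ hj hl)

theorem center_curveChart (h : IsCurveData a c) : (curveChart ξ a c h).center = ξ := by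
  ext j
  have h1 : constantCoeff (C (ξ j) + curveMap a c j) = ξ j := by
    simp [curveMap, zero_pow (h.pos _).ne']
  exact h1

theorem point_curveChart (h : IsCurveData a c) (t : 𝕜) :
    (curveChart ξ a c h).point (fun _ => t) = ξ + curve a c t := by
  ext j
  have h1 : aeval (fun _ => t) (C (ξ j) + curveMap a c j) = (ξ + curve a c t) j := by
    simp [curveMap, curve]
  exact h1

theorem evalAt_comp_diffOp_qPoly_eq (h : IsCurveData a c) (m : ℕ) :
    evalAt ξ ∘ₗ diffOp (qPoly a c m) = (curveChart ξ a c h).coeffDual fun _ => m := by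
  refine LinearMap.ext fun f => ?_
  exact evalAt_diffOp_qPoly h.pos c m ξ f

theorem mem_exps_curveChart (h : IsCurveData a c) {α : Fin 1 → ℕ} :
    α ∈ (curveChart ξ a c h).exps ↔ ∃ m ≤ a 1, (fun _ => m) = α := by
  change α ∈ (Finset.range (a 1 + 1)).image (fun m _ => m) ↔ _
  simp

end Charts

/-! ### Assembling the charts of the interpolation problem -/

section Family

variable {μ ν : ℕ} {ξ : Fin (μ + ν) → Fin d → 𝕜}
    {Δ : Fin μ → Finset (Fin d → ℕ)} {ρ : Fin μ → Fin d → Fin d → 𝕜}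
    {n : Fin ν → ℕ} {a : (l : Fin ν) → Fin (n l + 1) → ℕ}
    {c : (l : Fin ν) → Fin d → Fin (n l + 1) → 𝕜}

/-- All the charts of an interpolation problem. -/
def charts (ξ : Fin (μ + ν) → Fin d → 𝕜)
    (hΔ : ∀ k, IsLowerSet (Δ k : Set (Fin d → ℕ))) (hρ : ∀ k, IsUnitFrame (ρ k))
    (hac : ∀ l, IsCurveData (a l) (c l)) : Fin μ ⊕ Fin ν → LocalChart 𝕜 d
  | .inl k => frameChart (ξ (Fin.castAdd ν k)) (ρ k) (hρ k).linearIndependent (Δ k) (hΔ k)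
  | .inr l => curveChart (ξ (Fin.natAdd μ l)) (a l) (c l) (hac l)

theorem injective_center_charts (hξ : Function.Injective ξ)
    (hΔ : ∀ k, IsLowerSet (Δ k : Set (Fin d → ℕ))) (hρ : ∀ k, IsUnitFrame (ρ k))
    (hac : ∀ l, IsCurveData (a l) (c l)) :
    Function.Injective fun k => (charts ξ hΔ hρ hac k).center := by
  have h1 : (fun k => (charts ξ hΔ hρ hac k).center) = ξ ∘ finSumFinEquiv := by
    ext1 k
    rcases k with k | l
    · exact center_frameChart _ _ (hρ k).linearIndependent _ _
    · exact center_curveChart _ (hac l)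
  rw [h1]
  exact hξ.comp finSumFinEquiv.injective

theorem hermiteSpan_eq (hΔ : ∀ k, IsLowerSet (Δ k : Set (Fin d → ℕ)))
    (hρ : ∀ k, IsUnitFrame (ρ k)) (hac : ∀ l, IsCurveData (a l) (c l)) :
    hermiteSpan ξ Δ ρ n a c = Submodule.span 𝕜
      (Set.range fun j : ChartIndex (charts ξ hΔ hρ hac) =>
        (charts ξ hΔ hρ hac j.1).coeffDual j.2.1) := by
  set S := Submodule.span 𝕜
      (Set.range fun j : ChartIndex (charts ξ hΔ hρ hac) =>
        (charts ξ hΔ hρ hac j.1).coeffDual j.2.1)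
  have hS : ∀ k, ∀ α ∈ (charts ξ hΔ hρ hac k).exps, (charts ξ hΔ hρ hac k).coeffDual α ∈ S :=
    fun k α hα => Submodule.subset_span ⟨⟨k, α, hα⟩, rfl⟩
  apply le_antisymm
  · refine Submodule.span_le.2 (Set.union_subset ?_ ?_)
    · rintro _ ⟨k, α, hα, rfl⟩
      rw [evalAt_comp_dirDerivPow_eq _ _ (hρ k).linearIndependent (Δ k) (hΔ k)]
      exact S.smul_mem _ (hS (.inl k) α hα)
    · rintro _ ⟨l, m, hm, rfl⟩
      rw [evalAt_comp_diffOp_qPoly_eq _ (hac l)]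
      exact hS (.inr l) _ ((mem_exps_curveChart _ (hac l)).2 ⟨m, hm, rfl⟩)
  · refine Submodule.span_le.2 ?_
    rintro _ ⟨⟨k | l, α, hα⟩, rfl⟩
    -- Derivatives and Taylor coefficients differ by the factor α!, which is invertible in
    -- characteristic zero.
    · have h0 : (∏ i, ((α i).factorial : 𝕜)) ≠ 0 :=
        Finset.prod_ne_zero_iff.2 fun i _ => Nat.cast_ne_zero.2 (Nat.factorial_ne_zero _)
      rw [SetLike.mem_coe, ← Submodule.smul_mem_iff _ h0]
      have h1 := evalAt_comp_dirDerivPow_eq (ξ (Fin.castAdd ν k)) (ρ k)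
        (hρ k).linearIndependent (Δ k) (hΔ k) α
      exact Submodule.subset_span (Or.inl ⟨k, α, hα, h1.symm⟩)
    · obtain ⟨m, hm, rfl⟩ := (mem_exps_curveChart _ (hac l)).1 hα
      refine Submodule.subset_span ?_
      exact Or.inr ⟨l, m, hm, (evalAt_comp_diffOp_qPoly_eq _ (hac l) m).symm⟩

theorem lagrangeSpan_eq (hΔ : ∀ k, IsLowerSet (Δ k : Set (Fin d → ℕ)))
    (hρ : ∀ k, IsUnitFrame (ρ k)) (hac : ∀ l, IsCurveData (a l) (c l)) (h : 𝕜) :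
    lagrangeSpan ξ Δ ρ n a c h = Submodule.span 𝕜
      (Set.range fun j : ChartIndex (charts ξ hΔ hρ hac) =>
        evalAt ((charts ξ hΔ hρ hac j.1).point fun i => (j.2.1 i : 𝕜) * h)) := by
  rw [lagrangeSpan]
  congr 1
  apply Set.Subset.antisymm
  · refine Set.union_subset ?_ ?_
    · rintro _ ⟨k, α, hα, rfl⟩
      exact ⟨⟨.inl k, α, hα⟩,
        congrArg evalAt (point_frameChart _ _ (hρ k).linearIndependent _ (hΔ k) h α)⟩
    · rintro _ ⟨l, m, hm, rfl⟩
      exact ⟨⟨.inr l, _, (mem_exps_curveChart _ (hac l)).2 ⟨m, hm, rfl⟩⟩,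
        congrArg evalAt (point_curveChart _ (hac l) ((m : 𝕜) * h))⟩
  · rintro _ ⟨⟨k | l, α, hα⟩, rfl⟩
    · exact Or.inl ⟨k, α, hα,
        congrArg evalAt (point_frameChart _ _ (hρ k).linearIndependent _ (hΔ k) h α)⟩
    · obtain ⟨m, hm, rfl⟩ := (mem_exps_curveChart _ (hac l)).1 hα
      exact Or.inr ⟨l, m, hm, congrArg evalAt (point_curveChart _ (hac l) ((m : 𝕜) * h))⟩

end Family

end IdealProjector
end

theorem theorem1 {𝕜 : Type*} [RCLike 𝕜] {d μ ν : ℕ}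
    (ξ : Fin (μ + ν) → Fin d → 𝕜) (hξ : Function.Injective ξ)
    (Δ : Fin μ → Finset (Fin d → ℕ)) (hΔ : ∀ k, IsLowerSet (Δ k : Set (Fin d → ℕ)))
    (ρ : Fin μ → Fin d → Fin d → 𝕜) (hρ : ∀ k, IdealProjector.IsUnitFrame (ρ k))
    (n : Fin ν → ℕ) (a : (l : Fin ν) → Fin (n l + 1) → ℕ)
    (c : (l : Fin ν) → Fin d → Fin (n l + 1) → 𝕜)
    (hac : ∀ l, IdealProjector.IsCurveData (a l) (c l))
    (P : Module.End 𝕜 (MvPolynomial (Fin d) 𝕜))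
    (hP : IdealProjector.IsIdealProjector P)
    (hP' : IdealProjector.dualRange P = IdealProjector.hermiteSpan ξ Δ ρ n a c) :
    ∃ η : ℝ, 0 < η ∧ ∃ Ph : 𝕜 → Module.End 𝕜 (MvPolynomial (Fin d) 𝕜),
      (∀ h : 𝕜, 0 < ‖h‖ → ‖h‖ < η →
        (IdealProjector.IsLagrangeProjector (Ph h) ∧
          IdealProjector.dualRange (Ph h) = IdealProjector.lagrangeSpan ξ Δ ρ n a c h ∧
          LinearMap.range (Ph h) = LinearMap.range P) ∧
        ∀ Q : Module.End 𝕜 (MvPolynomial (Fin d) 𝕜),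
          IdealProjector.IsLagrangeProjector Q →
          IdealProjector.dualRange Q = IdealProjector.lagrangeSpan ξ Δ ρ n a c h →
          LinearMap.range Q = LinearMap.range P → Q = Ph h) ∧
      ∀ (f : MvPolynomial (Fin d) 𝕜) (β : Fin d →₀ ℕ),
        Tendsto (fun h : 𝕜 => (Ph h f).coeff β) (𝓝[≠] 0) (𝓝 ((P f).coeff β)) := by
  rw [IdealProjector.hermiteSpan_eq hΔ hρ hac] at hP'
  obtain ⟨η, hη, Ph, hPh, hlim⟩ := IdealProjector.exists_lagrange_tendsto _
    (IdealProjector.injective_center_charts hξ hΔ hρ hac) hP.1 hP'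
  refine ⟨η, hη, Ph, fun h h0 hh => ?_, fun f β => hlim (MvPolynomial.lcoeff 𝕜 β) f⟩
  rw [IdealProjector.lagrangeSpan_eq hΔ hρ hac]
  obtain ⟨h1, h2, h3⟩ := hPh h h0 hh
  exact ⟨⟨h1, h2, h3⟩, fun Q hQ hQ' hQr => IdealProjector.eq_of_range_eq_of_range_dualMap_eq
    hQ.1 h1.1 (hQr.trans h3.symm) (hQ'.trans h2.symm)⟩
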